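/- Let $S^4\mathbb{C}^5$ be the space of complex forms of degree $4$ in $x_0,\dots,x_4$. A point $P=[a_0:\dots:a_4]\in\mathbb{P}^4$ stands for the linear form $L_P=a_0x_0+\dots+a_4x_4$ (up to a scalar), and $v_d(P)=[L_P^d]$ is its image under the Veronese map of degree $d$. For a finite set $A\subset\mathbb{P}^4$ write $\ell(A)$ for its cardinality. We say that $A$ is a decomposition of a form $T\in S^4\mathbb{C}^5$ if $T$ lies in the linear span $\langle v_4(A)\rangle$, and that it is a non-redundant decomposition of $T$ if moreover no proper subset of $A$ is a decomposition of $T$. The $d$-th Kruskal rank $k_d(A)$ is the largest $k\le\ell(A)$ such that for every subset $S\subset A$ with $k$ elements the points $v_d(P)$, $P\in S$, are linearly independent. Let $T\in S^4\mathbb{C}^5$ have two distinct decompositions $A\ne B$ with $A\cap B\neq\emptyset$ and $13\ge\ell(A)\ge\ell(B)$. Assume that (i) $A$ is a non-redundant decomposition of $T$; (ii) $k_1(A)=5$; (iii) $k_2(A)=\ell(A)$. Then $\ell(B)=\ell(A)\ge 9$. Moreover, writing $r=\ell(A)$, there are an integer $r'\ge 9$, disjoint subsets $A'\subset A$ and $B'\subset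 B$ with $\ell(A')=\ell(B')=r'$, and a form $T_0\in S^4\mathbb{C}^5$ such that $A'$ and $B'$ are both non-redundant decompositions of $T_0$, the set $A\cap B=\{P_1,\dots,P_{r-r'}\}$ has exactly $r-r'$ points, and $$T=T_0+\sum_{i=1}^{r-r'}a_i\,L_{P_i}^4$$ for some $a_1,\dots,a_{r-r'}\in\mathbb{C}$, where $L_{P_i}$ is any fixed representative of $P_i$ (so that $L_{P_i}^4$ represents $v_4(P_i)$). -/

import Mathlib

/-- The projective space `ℙⁿ` over `ℂ`, whose points are the classes `[a₀ : … : aₙ]` of nonzero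
vectors; such a class is identified with the linear form `a₀ x₀ + … + aₙ xₙ` up to scalars. -/
abbrev ProjSpace (n : ℕ) : Type := Projectivization ℂ (Fin (n + 1) → ℂ)

/-- The space `S^d ℂ^{n+1}` of forms of degree `d` in the variables `x₀, …, xₙ`. -/
abbrev Form (n d : ℕ) : Type :=
  MvPolynomial.homogeneousSubmodule (Fin (n + 1)) ℂ d

/-- The linear form `a₀ x₀ + … + aₙ xₙ`. -/
noncomputable def linearForm {n : ℕ} (a : Fin (n + 1) → ℂ) : MvPolynomial (Fin (n + 1)) ℂ :=
  ∑ i, MvPolynomial.C (a i) * MvPolynomial.X i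

theorem linearForm_isHomogeneous {n : ℕ} (a : Fin (n + 1) → ℂ) :
    (linearForm a).IsHomogeneous 1 := by
  unfold linearForm
  refine MvPolynomial.IsHomogeneous.sum _ _ _ fun i _ => ?_
  simpa using (MvPolynomial.isHomogeneous_C (Fin (n + 1)) (a i)).mul
    (MvPolynomial.isHomogeneous_X ℂ i)

theorem linearForm_smul {n : ℕ} (t : ℂ) (a : Fin (n + 1) → ℂ) :
    linearForm (t • a) = t • linearForm a := by
  simp [linearForm, Finset.smul_sum, MvPolynomial.smul_eq_C_mul, mul_assoc]

theorem linearForm_ne_zero {n : ℕ} {a : Fin (n + 1) → ℂ} (ha : a ≠ 0) : linearForm a ≠ 0 := by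
  intro h
  apply ha
  funext i
  have := congrArg (MvPolynomial.eval (Pi.single i (1 : ℂ))) h
  simpa [linearForm, Pi.single_apply] using this

/-- The power `(a₀ x₀ + … + aₙ xₙ)^d`, as a form of degree `d`. -/
noncomputable def powerForm {n : ℕ} (d : ℕ) (a : Fin (n + 1) → ℂ) : Form n d :=
  ⟨linearForm a ^ d, by
    simpa [MvPolynomial.mem_homogeneousSubmodule] using (linearForm_isHomogeneous a).pow d⟩

theorem powerForm_ne_zero {n : ℕ} (d : ℕ) {a : Fin (n + 1) → ℂ} (ha : a ≠ 0) :
    powerForm d a ≠ 0 := by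
  intro h
  exact pow_ne_zero d (linearForm_ne_zero ha) (congrArg Subtype.val h)

theorem powerForm_smul {n : ℕ} (d : ℕ) (t : ℂ) (a : Fin (n + 1) → ℂ) :
    powerForm d (t • a) = t ^ d • powerForm d a := by
  apply Subtype.ext
  simp [powerForm, linearForm_smul, smul_pow]

/-- The Veronese map `v_d : ℙⁿ → ℙ(S^d ℂ^{n+1})`, sending `[L]` to `[L^d]`. -/
noncomputable def veronese {n : ℕ} (d : ℕ) : ProjSpace n → Projectivization ℂ (Form n d) :=
  Projectivization.lift
    (fun a : {a : Fin (n + 1) → ℂ // a ≠ 0} =>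
      Projectivization.mk ℂ (powerForm d a.1) (powerForm_ne_zero d a.2))
    (by
      rintro ⟨a, ha⟩ ⟨b, hb⟩ t h
      simp only at h
      rw [Projectivization.mk_eq_mk_iff']
      subst h
      exact ⟨t ^ d, (powerForm_smul d t b).symm⟩)

/-- The linear span `⟨v_d(A)⟩`, as a linear subspace of `S^d ℂ^{n+1}`. -/
noncomputable def veroneseSpan {n : ℕ} (d : ℕ) (A : Finset (ProjSpace n)) :
    Submodule ℂ (Form n d) :=
  ⨆ P ∈ A, (veronese d P).submodule

/-- `A` computes `T` (is a decomposition of `T`): `T ∈ ⟨v_d(A)⟩`. -/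
def Computes {n d : ℕ} (A : Finset (ProjSpace n)) (T : Form n d) : Prop :=
  T ∈ veroneseSpan d A

/-- `A` is a non-redundant decomposition of `T`: it computes `T`, and no proper subset does. -/
def IsNonRedundant {n d : ℕ} (A : Finset (ProjSpace n)) (T : Form n d) : Prop :=
  Computes A T ∧ ∀ A' : Finset (ProjSpace n), A' ⊂ A → ¬ Computes A' T

/-- The `d`-th Kruskal rank `k_d(A)`: the largest `k ≤ ℓ(A)` such that for every subset
`S ⊆ A` of `k` points the points `v_d(P)`, `P ∈ S`, are linearly independent. -/
noncomputable def kruskalRank {n : ℕ} (d : ℕ) (A : Finset (ProjSpace n)) : ℕ :=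
  sSup {k : ℕ | k ≤ A.card ∧ ∀ S : Finset (ProjSpace n), S ⊆ A → S.card = k →
    Projectivization.Independent (fun P : S => veronese d (P : ProjSpace n))}

/-!
Write `T` as a combination of the fourth powers of the points of `A`, with coefficients `c`, and of
those of the points of `B`, with coefficients `e`. Non-redundancy makes every `c P` nonzero, and
`k₂(A) = ℓ(A)` says that the squares `L_P²`, `P ∈ A`, are independent. Contracting such an
expression with the functionals on quadrics computes the image of the middle catalecticant of `T`:
it is the span of the squares of `A`, and it lies in the span of the squares of `B`
(`span_powerForm_le_of_sum_eq`). Hence `ℓ(A) ≤ ℓ(B)` (`card_le_of_sum_eq`), so `ℓ(A) = ℓ(B)`.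

The same comparison applies to the difference of the two expressions. Its terms at points of `A`
are those of `A \ B` and those of the `P ∈ A ∩ B` with `c P ≠ e P`, and their number is at most
`ℓ(B \ A) = ℓ(A \ B)`. So `c` and `e` agree on `A ∩ B` (`coeff_eq_on_inter_of_sum_eq`), and what
remains of `T` is one form `T₀` decomposed by both `A \ B` and `B \ A`. The comparison also shows
that no fewer than `ℓ(A \ B)` points compute `T₀`, which gives non-redundancy
(`isNonRedundant_of_card_le`), and that the squares of `A \ B` and of `B \ A` span the same space
(`span_powerForm_eq_of_sum_eq`).

Finally `k₁(A) = 5` puts the points of `A` in linearly general position. If `A \ B` had at most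
eight points, then no further point `Q` would have its square in the span of theirs: a relation
between the squares would contradict the subadditivity of the rank of quadratic forms, which is the
comparison above in degree one (`powerForm_two_notMem_span`). Since `B \ A` is nonempty, `A \ B` has
at least nine points.
-/

/-! ### Contraction of powers of linear forms -/

/-- The multinomial theorem: for `k` of degree `d`, the form `M k` is the monomial `X ^ k` times a
multinomial coefficient. -/
theorem exists_powerForm_eq_sum (n d : ℕ) :
    ∃ M : (Fin (n + 1) → ℕ) → Form n d, ∀ a : Fin (n + 1) → ℂ,
      powerForm d a = ∑ k ∈ Finset.univ.piAntidiag d, (∏ i, a i ^ k i) • M k := by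
  -- Taking the component of degree `d` makes `M k` a form for every `k`, also off degree `d`.
  refine ⟨fun k => ⟨MvPolynomial.homogeneousComponent d
    ((Nat.multinomial Finset.univ k : MvPolynomial (Fin (n + 1)) ℂ) *
      ∏ i, MvPolynomial.X i ^ k i), MvPolynomial.homogeneousComponent_mem _ _⟩, fun a => ?_⟩
  apply Subtype.ext
  have h1 : linearForm a ^ d = ∑ k ∈ Finset.univ.piAntidiag d, (∏ i, a i ^ k i) •
      ((Nat.multinomial Finset.univ k : MvPolynomial (Fin (n + 1)) ℂ) *
        ∏ i, MvPolynomial.X i ^ k i) := by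
    rw [linearForm, Finset.sum_pow_eq_sum_piAntidiag]
    refine Finset.sum_congr rfl fun k _ => ?_
    simp only [mul_pow, Finset.prod_mul_distrib, MvPolynomial.smul_eq_C_mul, map_prod, map_pow]
    ring
  have h2 := congrArg (MvPolynomial.homogeneousComponent d) h1
  have h3 : MvPolynomial.homogeneousComponent d (linearForm a ^ d) = linearForm a ^ d := by
    have hm : linearForm a ^ d ∈ MvPolynomial.homogeneousSubmodule (Fin (n + 1)) ℂ d :=
      (powerForm d a).2
    rw [MvPolynomial.homogeneousComponent_of_mem hm, if_pos rfl]
  rw [h3, map_sum] at h2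
  simpa [powerForm] using h2

theorem exists_monomial_functional {n d : ℕ} {k : Fin (n + 1) → ℕ} (hk : ∑ i, k i = d) :
    ∃ φ : Form n d →ₗ[ℂ] ℂ, ∀ a : Fin (n + 1) → ℂ, φ (powerForm d a) = ∏ i, a i ^ k i := by
  set s : Fin (n + 1) →₀ ℕ := Finsupp.equivFunOnFinite.symm k with hs
  have hsum : (s.sum fun _ m => m) = d := by
    rw [Finsupp.sum_fintype _ _ (fun _ => rfl)]; simpa [hs] using hk
  -- The coefficient of `L_a ^ d` at `X ^ k` is a multinomial coefficient times `a ^ k`.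
  refine ⟨(s.multinomial : ℂ)⁻¹ • (MvPolynomial.lcoeff ℂ s ∘ₗ Submodule.subtype _), fun a => ?_⟩
  have hc := MvPolynomial.coeff_linearCombination_X_pow_of_fintype a s d
  rw [if_pos hsum, Finsupp.prod_fintype _ _ (fun _ => pow_zero _)] at hc
  have hmult : (s.multinomial : ℂ) ≠ 0 := by
    rw [Finsupp.multinomial_eq]; exact_mod_cast (Nat.multinomial_pos _ _).ne'
  have hl : linearForm a = ∑ i, a i • (MvPolynomial.X i : MvPolynomial (Fin (n + 1)) ℂ) := by
    simp [linearForm, MvPolynomial.smul_eq_C_mul]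
  simp only [powerForm, LinearMap.smul_apply, LinearMap.comp_apply, Submodule.subtype_apply,
    MvPolynomial.lcoeff_apply, hl, hc, smul_eq_mul]
  rw [inv_mul_cancel_left₀ hmult]
  simp [hs]

/-- Contraction by a functional `f` on forms of degree `e`. It is apolarity in a form that avoids
differential operators: all that is used of it is its value on powers of linear forms. -/
theorem exists_contraction {n d e : ℕ} (f : Form n e →ₗ[ℂ] ℂ) :
    ∃ D : Form n (d + e) →ₗ[ℂ] Form n d, ∀ a : Fin (n + 1) → ℂ,
      D (powerForm (d + e) a) = f (powerForm e a) • powerForm d a := by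
  obtain ⟨M, hM⟩ := exists_powerForm_eq_sum n d
  obtain ⟨N, hN⟩ := exists_powerForm_eq_sum n e
  have hφ : ∀ p : (Fin (n + 1) → ℕ) × (Fin (n + 1) → ℕ), ∃ φ : Form n (d + e) →ₗ[ℂ] ℂ,
      p.1 ∈ Finset.univ.piAntidiag d → p.2 ∈ Finset.univ.piAntidiag e →
        ∀ a : Fin (n + 1) → ℂ, φ (powerForm (d + e) a) = ∏ i, a i ^ (p.1 i + p.2 i) := by
    intro p
    by_cases h : p.1 ∈ Finset.univ.piAntidiag d ∧ p.2 ∈ Finset.univ.piAntidiag e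
    · have hk : ∑ i, (p.1 i + p.2 i) = d + e := by
        rw [Finset.sum_add_distrib, (Finset.mem_piAntidiag.1 h.1).1,
          (Finset.mem_piAntidiag.1 h.2).1]
      obtain ⟨φ, h'⟩ := exists_monomial_functional hk
      exact ⟨φ, fun _ _ => h'⟩
    · exact ⟨0, fun h1 h2 => absurd ⟨h1, h2⟩ h⟩
  choose φ hφ using hφ
  refine ⟨∑ k ∈ Finset.univ.piAntidiag d, ∑ l ∈ Finset.univ.piAntidiag e,
    (φ (k, l)).smulRight (f (N l) • M k), fun a => ?_⟩
  simp only [LinearMap.sum_apply, LinearMap.smulRight_apply]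
  conv_rhs => rw [hM a, hN a, Finset.smul_sum]
  refine Finset.sum_congr rfl fun k hk => ?_
  rw [map_sum, Finset.sum_smul]
  refine Finset.sum_congr rfl fun l hl => ?_
  rw [hφ (k, l) hk hl a, map_smul]
  simp only [pow_add, Finset.prod_mul_distrib, smul_smul, smul_eq_mul]
  congr 1
  ring

/-! ### Rearranging linear relations -/

theorem sum_eq_sum_insert_sdiff {K V ι : Type*} [Ring K] [AddCommGroup V] [Module K V]
    [DecidableEq ι] {v : ι → V} {S S₀ : Finset ι} {q : ι} {α : ι → K} (hS : S ⊆ S₀)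
    (hq : q ∉ S₀ \ S) (h : ∑ i ∈ S₀, α i • v i = v q) :
    ∑ i ∈ S, α i • v i = ∑ i ∈ insert q (S₀ \ S), (if i = q then 1 else -α i) • v i := by
  have h1 : ∑ i ∈ S₀ \ S, (if i = q then 1 else -α i) • v i = -∑ i ∈ S₀ \ S, α i • v i := by
    rw [← Finset.sum_neg_distrib]
    refine Finset.sum_congr rfl fun i hi => ?_
    rw [if_neg fun h : i = q => hq (h ▸ hi), neg_smul]
  rw [Finset.sum_insert hq, if_pos rfl, one_smul, h1, ← h, ← Finset.sum_sdiff hS]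
  abel

theorem sum_filter_sub_smul_eq {K V ι : Type*} [Ring K] [DecidableEq K] [AddCommGroup V]
    [Module K V] [DecidableEq ι] {v : ι → V} {A B : Finset ι} {c e : ι → K}
    (h : ∑ i ∈ A, c i • v i = ∑ i ∈ B, e i • v i) :
    ∑ i ∈ A with (c i - if i ∈ B then e i else 0) ≠ 0,
      (c i - if i ∈ B then e i else 0) • v i = ∑ i ∈ B \ A, e i • v i := by
  rw [Finset.sum_filter_of_ne (p := fun i => (c i - if i ∈ B then e i else 0) ≠ 0)
    fun i _ h h0 => h (by rw [h0, zero_smul])]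
  simp only [sub_smul, Finset.sum_sub_distrib, ite_smul, zero_smul]
  rw [← Finset.sum_filter, Finset.filter_mem_eq_inter, sub_eq_iff_eq_add, Finset.inter_comm,
    add_comm, Finset.sum_inter_add_sum_sdiff]
  exact h

theorem sum_sdiff_eq_of_sum_eq {K V ι : Type*} [Ring K] [AddCommGroup V] [Module K V]
    [DecidableEq ι] {v : ι → V} {A B : Finset ι} {c e : ι → K} (hce : ∀ i ∈ A ∩ B, c i = e i)
    (h : ∑ i ∈ A, c i • v i = ∑ i ∈ B, e i • v i) :
    ∑ i ∈ A \ B, c i • v i = ∑ i ∈ B \ A, e i • v i := by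
  rw [← Finset.sum_inter_add_sum_sdiff A B, ← Finset.sum_inter_add_sum_sdiff B A,
    Finset.inter_comm B A,
    Finset.sum_congr rfl fun i hi => congrArg (· • v i) (hce i hi)] at h
  exact add_left_cancel h

/-! ### Comparison of two expressions of the same form -/

/-- If a form of degree `2 d` is a combination of `2 d`-th powers indexed by `A`, with nonzero
coefficients and independent `d`-th powers, then the image of its catalecticant is spanned by the
`d`-th powers indexed by `A`; any other expression, indexed by `B`, must span that image too. -/
theorem span_powerForm_le_of_sum_eq {n d m : ℕ} (hm : m = d + d) {ι : Type*}
    {x : ι → Fin (n + 1) → ℂ} {A B : Finset ι} {c e : ι → ℂ}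
    (hA : LinearIndepOn ℂ (fun i => powerForm d (x i)) (A : Set ι)) (hc : ∀ i ∈ A, c i ≠ 0)
    (h : ∑ i ∈ A, c i • powerForm m (x i) = ∑ i ∈ B, e i • powerForm m (x i)) :
    Submodule.span ℂ ((fun i => powerForm d (x i)) '' A) ≤
      Submodule.span ℂ ((fun i => powerForm d (x i)) '' B) := by
  classical
  subst hm
  rw [Submodule.span_le]
  rintro _ ⟨p, hp, rfl⟩
  -- A functional dual to `p`: it takes the value `1` at `p` and vanishes on the rest of `A`.
  obtain ⟨f, hf⟩ : ∃ f : Form n d →ₗ[ℂ] ℂ, ∀ i ∈ A, f (powerForm d (x i)) =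
      if i = p then 1 else 0 := by
    have hli : LinearIndependent ℂ (fun i : (A : Set ι) => powerForm d (x i)) := hA
    obtain ⟨f, hf⟩ := LinearMap.exists_extend
      ((Module.Basis.span hli).constr ℂ fun i : (A : Set ι) => if (i : ι) = p then (1 : ℂ) else 0)
    refine ⟨f, fun i hi => ?_⟩
    have h1 := LinearMap.congr_fun hf (Module.Basis.span hli ⟨i, hi⟩)
    rw [Module.Basis.constr_basis] at h1
    simpa [Module.Basis.span_apply] using h1
  obtain ⟨D, hD⟩ := exists_contraction (d := d) f
  have hrel := congrArg D h
  simp only [map_sum, map_smul, hD] at hrel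
  rw [Finset.sum_eq_single_of_mem p hp
    (fun i hi hne => by rw [hf i hi, if_neg hne, zero_smul, smul_zero]),
    hf p hp, if_pos rfl, one_smul] at hrel
  rw [SetLike.mem_coe, ← Submodule.smul_mem_iff _ (hc p hp), hrel]
  exact Submodule.sum_mem _ fun i hi => Submodule.smul_mem _ _ <| Submodule.smul_mem _ _ <|
    Submodule.subset_span ⟨i, hi, rfl⟩

theorem finrank_span_image_finset {V ι : Type*} [AddCommGroup V] [Module ℂ V] {v : ι → V}
    {A : Finset ι} (hA : LinearIndepOn ℂ v (A : Set ι)) :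
    Module.finrank ℂ (Submodule.span ℂ (v '' A)) = A.card := by
  have h := finrank_span_eq_card (b := fun i : (A : Set ι) => v i) hA
  rw [Set.image_eq_range, h]
  simp

theorem finrank_span_image_finset_le {V ι : Type*} [AddCommGroup V] [Module ℂ V] (v : ι → V)
    (A : Finset ι) :
    Module.finrank ℂ (Submodule.span ℂ (v '' A)) ≤ A.card := by
  classical
  rw [← Finset.coe_image]
  exact (finrank_span_finset_le_card _).trans Finset.card_image_le

theorem card_le_of_sum_eq {n d m : ℕ} (hm : m = d + d) {ι : Type*}
    {x : ι → Fin (n + 1) → ℂ} {A B : Finset ι} {c e : ι → ℂ}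
    (hA : LinearIndepOn ℂ (fun i => powerForm d (x i)) (A : Set ι)) (hc : ∀ i ∈ A, c i ≠ 0)
    (h : ∑ i ∈ A, c i • powerForm m (x i) = ∑ i ∈ B, e i • powerForm m (x i)) :
    A.card ≤ B.card := by
  classical
  rw [← finrank_span_image_finset hA]
  have : FiniteDimensional ℂ (Submodule.span ℂ ((fun i => powerForm d (x i)) '' (B : Set ι))) :=
    FiniteDimensional.span_of_finite ℂ (B.finite_toSet.image _)
  exact (Submodule.finrank_mono (span_powerForm_le_of_sum_eq hm hA hc h)).trans
    (finrank_span_image_finset_le _ _)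

/-- The two sides span the same space when they have the same number of terms. -/
theorem span_powerForm_eq_of_sum_eq {n d m : ℕ} (hm : m = d + d) {ι : Type*}
    {x : ι → Fin (n + 1) → ℂ} {A B : Finset ι} {c e : ι → ℂ}
    (hA : LinearIndepOn ℂ (fun i => powerForm d (x i)) (A : Set ι)) (hc : ∀ i ∈ A, c i ≠ 0)
    (h : ∑ i ∈ A, c i • powerForm m (x i) = ∑ i ∈ B, e i • powerForm m (x i))
    (hcard : B.card ≤ A.card) :
    Submodule.span ℂ ((fun i => powerForm d (x i)) '' A) =
      Submodule.span ℂ ((fun i => powerForm d (x i)) '' B) := by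
  classical
  have : FiniteDimensional ℂ (Submodule.span ℂ ((fun i => powerForm d (x i)) '' (B : Set ι))) :=
    FiniteDimensional.span_of_finite ℂ (B.finite_toSet.image _)
  refine Submodule.eq_of_le_of_finrank_le (span_powerForm_le_of_sum_eq hm hA hc h) ?_
  rw [finrank_span_image_finset hA]
  exact (finrank_span_image_finset_le _ _).trans hcard

/-- Subtracting the common part of both expressions leaves an expression supported on `A \ B` and on
the common points where `c` and `e` differ; there are no points of the latter kind, since `A \ B`
already has as many points as `B \ A`. -/
theorem coeff_eq_on_inter_of_sum_eq {n d m : ℕ} (hm : m = d + d) {ι : Type*} [DecidableEq ι]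
    {x : ι → Fin (n + 1) → ℂ} {A B : Finset ι} {c e : ι → ℂ}
    (hA : LinearIndepOn ℂ (fun i => powerForm d (x i)) (A : Set ι)) (hc : ∀ i ∈ A, c i ≠ 0)
    (h : ∑ i ∈ A, c i • powerForm m (x i) = ∑ i ∈ B, e i • powerForm m (x i))
    (hsdiff : (A \ B).card = (B \ A).card) : ∀ i ∈ A ∩ B, c i = e i := by
  set g : ι → ℂ := fun P => c P - if P ∈ B then e P else 0 with hg
  have hrel : ∑ P ∈ A with g P ≠ 0, g P • powerForm m (x P) =
      ∑ P ∈ B \ A, e P • powerForm m (x P) :=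
    sum_filter_sub_smul_eq h
  have hle' := card_le_of_sum_eq hm (hA.mono (Finset.coe_subset.2 (Finset.filter_subset _ _)))
    (fun P hP => (Finset.mem_filter.1 hP).2) hrel
  have hsub : A \ B ⊆ A.filter fun P => g P ≠ 0 := by
    intro P hP
    obtain ⟨hPA, hPB⟩ := Finset.mem_sdiff.1 hP
    simpa [hg, hPB, hPA] using hc P hPA
  have hfe := Finset.eq_of_subset_of_card_le hsub (hle'.trans hsdiff.ge)
  intro P hP
  obtain ⟨hPA, hPB⟩ := Finset.mem_inter.1 hP
  by_contra hne'
  have hmem : P ∈ A \ B := by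
    rw [hfe, Finset.mem_filter]
    exact ⟨hPA, by simpa [hg, hPB] using sub_ne_zero.2 hne'⟩
  exact (Finset.mem_sdiff.1 hmem).2 hPB

/-! ### Points in linearly general position -/

theorem rep_notMem_span_powerForm_one {n : ℕ} {P Q : ProjSpace n} (h : P ≠ Q) :
    powerForm 1 P.rep ∉ Submodule.span ℂ {powerForm 1 Q.rep} := by
  intro hm
  obtain ⟨t, ht⟩ := Submodule.mem_span_singleton.1 hm
  have h1 : linearForm (t • Q.rep - P.rep) = 0 := by
    have h2 := congrArg Subtype.val ht
    simp only [powerForm, SetLike.val_smul, pow_one] at h2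
    rw [sub_eq_add_neg, ← neg_one_smul ℂ P.rep]
    have h3 : ∀ a b : Fin (n + 1) → ℂ, linearForm (a + b) = linearForm a + linearForm b := by
      intro a b; simp [linearForm, add_mul, Finset.sum_add_distrib]
    rw [h3, linearForm_smul, linearForm_smul, h2]; simp
  have h2 : t • Q.rep = P.rep := by
    by_contra hne
    exact linearForm_ne_zero (sub_ne_zero.2 hne) h1
  apply h
  rw [← P.mk_rep, ← Q.mk_rep, Projectivization.mk_eq_mk_iff']
  exact ⟨t, h2⟩

/-- At most `2 n` points of `ℙⁿ` in linearly general position are cut out by quadrics. In a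
relation between `L_Q ^ 2` and the squares of the points of `A`, `min (n + 1) s` of the `s` terms
with nonzero coefficient form a quadratic form of that rank, while the other terms, with `L_Q ^ 2`,
have rank at most `1 + s - min (n + 1) s`. As `s ≤ 2 n`, this forces `s ≤ 1`, and a proportionality
of two squares is excluded by `Q ∉ A`. -/
theorem powerForm_two_notMem_span {n : ℕ} {A : Finset (ProjSpace n)} {Q : ProjSpace n}
    (hlgp : ∀ S ⊆ A, S.card ≤ n + 1 →
      LinearIndepOn ℂ (fun P : ProjSpace n => powerForm 1 P.rep) (S : Set (ProjSpace n)))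
    (hcard : A.card ≤ 2 * n) (hQ : Q ∉ A) :
    powerForm 2 Q.rep ∉
      Submodule.span ℂ ((fun P : ProjSpace n => powerForm 2 P.rep) '' A) := by
  classical
  intro hm
  obtain ⟨α, hα⟩ := (Submodule.mem_span_image_finset_iff_exists_fun' ℂ).1 hm
  set S₀ := A.filter (fun P => α P ≠ 0) with hS₀
  have hα' : ∑ P ∈ S₀, α P • powerForm 2 P.rep = powerForm 2 Q.rep := by
    rw [← hα]
    exact Finset.sum_filter_of_ne fun P _ h h0 => h (by rw [h0, zero_smul])
  have hS₀A : S₀ ⊆ A := Finset.filter_subset _ _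
  obtain ⟨S, hS, hScard⟩ := Finset.exists_subset_card_eq (s := S₀) (n := min (n + 1) S₀.card)
    (min_le_right _ _)
  have hQS : Q ∉ S₀ \ S := fun h => hQ (hS₀A (Finset.sdiff_subset h))
  have hrel : ∑ P ∈ S, α P • powerForm 2 P.rep =
      ∑ P ∈ insert Q (S₀ \ S), (if P = Q then 1 else -α P) • powerForm 2 P.rep :=
    sum_eq_sum_insert_sdiff hS hQS hα'
  have hne : ∀ P ∈ S, α P ≠ 0 := fun P hP => (Finset.mem_filter.1 (hS hP)).2
  have hli := hlgp S (hS.trans hS₀A) (hScard ▸ min_le_left _ _)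
  have hle := card_le_of_sum_eq rfl hli hne hrel
  rw [Finset.card_insert_of_notMem hQS, Finset.card_sdiff_of_subset hS, hScard] at hle
  have hS₀card : S₀.card ≤ A.card := Finset.card_le_card hS₀A
  have hS₀one : S₀.card ≤ 1 := by omega
  have hSS₀ : S = S₀ := Finset.eq_of_subset_of_card_le hS (by omega)
  have hspan := span_powerForm_le_of_sum_eq rfl hli hne hrel
  rw [hSS₀] at hspan
  simp only [Finset.sdiff_self, insert_empty_eq, Finset.coe_singleton, Set.image_singleton]
    at hspan
  rcases S₀.eq_empty_or_nonempty with h0 | ⟨P, hP⟩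
  · rw [h0, Finset.sum_empty] at hα'
    exact powerForm_ne_zero 2 Q.rep_nonzero hα'.symm
  · exact rep_notMem_span_powerForm_one (fun h : P = Q => hQ (h ▸ hS₀A hP))
      (hspan (Submodule.subset_span ⟨P, hP, rfl⟩))

/-! ### Decompositions and Kruskal ranks in coordinates -/

theorem exists_veronese_rep {n : ℕ} (d : ℕ) (P : ProjSpace n) :
    ∃ t : ℂˣ, t • powerForm d P.rep = (veronese d P).rep := by
  have h : veronese d P =
      Projectivization.mk ℂ (powerForm d P.rep) (powerForm_ne_zero d P.rep_nonzero) := by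
    conv_lhs => rw [← P.mk_rep]
    rfl
  rw [h]
  exact Projectivization.exists_smul_eq_mk_rep ℂ (powerForm d P.rep) _

theorem veroneseSpan_eq_span {n d : ℕ} (A : Finset (ProjSpace n)) :
    veroneseSpan d A =
      Submodule.span ℂ ((fun P : ProjSpace n => powerForm d P.rep) '' A) := by
  have h : ∀ P : ProjSpace n, (veronese d P).submodule = Submodule.span ℂ {powerForm d P.rep} := by
    intro P
    obtain ⟨t, ht⟩ := exists_veronese_rep d P
    rw [Projectivization.submodule_eq, ← ht]
    exact Submodule.span_singleton_group_smul_eq ℂ t _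
  rw [Set.image_eq_iUnion, Submodule.span_iUnion₂]
  simp only [veroneseSpan, h, Finset.mem_coe]

theorem computes_iff {n d : ℕ} {A : Finset (ProjSpace n)} {T : Form n d} :
    Computes A T ↔ ∃ c : ProjSpace n → ℂ, ∑ P ∈ A, c P • powerForm d P.rep = T := by
  rw [Computes, veroneseSpan_eq_span]
  exact Submodule.mem_span_image_finset_iff_exists_fun' ℂ

theorem independent_veronese_iff {n d : ℕ} {A : Finset (ProjSpace n)} :
    Projectivization.Independent (fun P : A => veronese d (P : ProjSpace n)) ↔
      LinearIndepOn ℂ (fun P : ProjSpace n => powerForm d P.rep) (A : Set (ProjSpace n)) := by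
  choose t ht using exists_veronese_rep (n := n) d
  rw [Projectivization.independent_iff]
  have h : Projectivization.rep ∘ (fun P : A => veronese d (P : ProjSpace n)) =
      (fun P : A => t P) • fun P : A => powerForm d (P : ProjSpace n).rep := by
    funext P; exact (ht P).symm
  rw [h, LinearIndependent.units_smul_iff]
  rfl

theorem kruskalRank_spec {n : ℕ} (d : ℕ) (A : Finset (ProjSpace n)) :
    kruskalRank d A ≤ A.card ∧ ∀ S ⊆ A, S.card ≤ kruskalRank d A →
      LinearIndepOn ℂ (fun P : ProjSpace n => powerForm d P.rep) (S : Set (ProjSpace n)) := by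
  have hmem := Nat.sSup_mem (s := {k : ℕ | k ≤ A.card ∧ ∀ S : Finset (ProjSpace n), S ⊆ A →
      S.card = k → Projectivization.Independent (fun P : S => veronese d (P : ProjSpace n))})
    ⟨0, Nat.zero_le _, fun S _ hS => by
      rw [independent_veronese_iff, Finset.card_eq_zero.1 hS, Finset.coe_empty]
      exact linearIndepOn_empty _ _⟩
    ⟨A.card, fun _ hk => hk.1⟩
  refine ⟨hmem.1, fun S hSA hS => ?_⟩
  obtain ⟨S', hSS', hS'A, hcard⟩ := Finset.exists_subsuperset_card_eq hSA hS hmem.1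
  exact (independent_veronese_iff.1 (hmem.2 S' hS'A hcard)).mono (Finset.coe_subset.2 hSS')

theorem IsNonRedundant.coeff_ne_zero {n d : ℕ} {A : Finset (ProjSpace n)} {T : Form n d}
    (hA : IsNonRedundant A T) {c : ProjSpace n → ℂ}
    (hc : ∑ P ∈ A, c P • powerForm d P.rep = T) : ∀ P ∈ A, c P ≠ 0 := by
  classical
  intro P hP h0
  refine hA.2 _ (Finset.erase_ssubset hP) (computes_iff.2 ⟨c, ?_⟩)
  rw [← hc]
  exact Finset.sum_erase _ (by rw [h0, zero_smul])

/-- An expression of `T` over `A` as in `card_le_of_sum_eq` forces every set computing `T` to have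
at least `ℓ(A)` points, so a set `B` that attains this minimum is non-redundant. -/
theorem isNonRedundant_of_card_le {n d m : ℕ} (hm : m = d + d)
    {A B : Finset (ProjSpace n)} {c : ProjSpace n → ℂ} {T : Form n m}
    (hA : LinearIndepOn ℂ (fun P : ProjSpace n => powerForm d P.rep) (A : Set (ProjSpace n)))
    (hc : ∀ P ∈ A, c P ≠ 0) (hT : ∑ P ∈ A, c P • powerForm m P.rep = T)
    (hB : Computes B T) (hcard : B.card ≤ A.card) : IsNonRedundant B T := by
  refine ⟨hB, fun B' hB' hcomp => ?_⟩
  obtain ⟨e, he⟩ := computes_iff.1 hcomp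
  exact absurd (card_le_of_sum_eq hm hA hc (hT.trans he.symm))
    (not_le.2 ((Finset.card_lt_card hB').trans_le hcard))

/-! ### Two decompositions of a quartic -/

theorem mainTheorem6 [DecidableEq (ProjSpace 4)]
    (T : Form 4 4) (A B : Finset (ProjSpace 4))
    (hi : IsNonRedundant A T) (hii : kruskalRank 1 A = 5) (hiii : kruskalRank 2 A = A.card)
    (hB : Computes B T) (hne : A ≠ B) (hAB : ¬ Disjoint A B)
    (h13 : A.card ≤ 13) (hle : B.card ≤ A.card) :
    B.card = A.card ∧ 9 ≤ A.card ∧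
      ∃ (r' : ℕ) (A' B' : Finset (ProjSpace 4)) (T₀ : Form 4 4) (a : ProjSpace 4 → ℂ),
        A' ⊆ A ∧ B' ⊆ B ∧ Disjoint A' B' ∧
        A'.card = r' ∧ B'.card = r' ∧ 9 ≤ r' ∧
        IsNonRedundant A' T₀ ∧ IsNonRedundant B' T₀ ∧
        (A ∩ B).card + r' = A.card ∧
        T = T₀ + ∑ P ∈ A ∩ B, a P • powerForm 4 P.rep := by
  have hlgp : ∀ S ⊆ A, S.card ≤ 4 + 1 →
      LinearIndepOn ℂ (fun P : ProjSpace 4 => powerForm 1 P.rep) (S : Set (ProjSpace 4)) :=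
    fun S hS hcard => (kruskalRank_spec 1 A).2 S hS (hii ▸ hcard)
  have hA2 : ∀ S ⊆ A,
      LinearIndepOn ℂ (fun P : ProjSpace 4 => powerForm 2 P.rep) (S : Set (ProjSpace 4)) :=
    fun S hS => (kruskalRank_spec 2 A).2 S hS (hiii ▸ Finset.card_le_card hS)
  obtain ⟨c, hc⟩ := computes_iff.1 hi.1
  obtain ⟨e, he⟩ := computes_iff.1 hB
  have hc0 := hi.coeff_ne_zero hc
  have hcard : B.card = A.card :=
    le_antisymm hle (card_le_of_sum_eq rfl (hA2 A subset_rfl) hc0 (hc.trans he.symm))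
  have hsdiff : (A \ B).card = (B \ A).card := by
    have h1 := Finset.card_sdiff_add_card_inter A B
    have h2 := Finset.card_sdiff_add_card_inter B A
    rw [Finset.inter_comm] at h2
    omega
  have heq := coeff_eq_on_inter_of_sum_eq rfl (hA2 A subset_rfl) hc0 (hc.trans he.symm) hsdiff
  have hTA : T = ∑ P ∈ A \ B, c P • powerForm 4 P.rep +
      ∑ P ∈ A ∩ B, c P • powerForm 4 P.rep :=
    hc.symm.trans ((add_comm _ _).trans (Finset.sum_inter_add_sum_sdiff A B _)).symm
  have hrel : ∑ P ∈ A \ B, c P • powerForm 4 P.rep =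
      ∑ P ∈ B \ A, e P • powerForm 4 P.rep :=
    sum_sdiff_eq_of_sum_eq heq (hc.trans he.symm)
  have hc0' : ∀ P ∈ A \ B, c P ≠ 0 := fun P hP => hc0 P (Finset.sdiff_subset hP)
  have hA2' := hA2 (A \ B) Finset.sdiff_subset
  -- With at most `8` points, `A \ B` would be cut out by quadrics, but every quadric through it
  -- vanishes on `B \ A`.
  have h9 : 9 ≤ (A \ B).card := by
    by_contra! hlt
    obtain ⟨Q, hQ⟩ : (B \ A).Nonempty := by
      rw [Finset.nonempty_iff_ne_empty, Ne, Finset.sdiff_eq_empty_iff_subset]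
      exact fun h => hne (Finset.eq_of_subset_of_card_le h hcard.ge).symm
    refine powerForm_two_notMem_span (A := A \ B) (Q := Q)
      (fun S hS => hlgp S (hS.trans Finset.sdiff_subset)) (by omega)
      (fun h => (Finset.mem_sdiff.1 hQ).2 (Finset.sdiff_subset h)) ?_
    rw [span_powerForm_eq_of_sum_eq rfl hA2' hc0' hrel hsdiff.ge]
    exact Submodule.subset_span ⟨Q, hQ, rfl⟩
  obtain ⟨T₀, hT₀⟩ : ∃ T₀ : Form 4 4, ∑ P ∈ A \ B, c P • powerForm 4 P.rep = T₀ := ⟨_, rfl⟩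
  have hNA : IsNonRedundant (A \ B) T₀ :=
    isNonRedundant_of_card_le (d := 2) (c := c) rfl hA2' hc0' hT₀ (computes_iff.2 ⟨c, hT₀⟩) le_rfl
  have hNB : IsNonRedundant (B \ A) T₀ :=
    isNonRedundant_of_card_le (d := 2) (c := c) rfl hA2' hc0' hT₀
      (computes_iff.2 ⟨e, hrel.symm.trans hT₀⟩) hsdiff.ge
  rw [hT₀] at hTA
  have hinter : (A ∩ B).card + (A \ B).card = A.card :=
    (add_comm _ _).trans (Finset.card_sdiff_add_card_inter A B)
  exact ⟨hcard, h9.trans (Finset.card_le_card Finset.sdiff_subset), (A \ B).card, A \ B, B \ A,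
    T₀, c, Finset.sdiff_subset, Finset.sdiff_subset, disjoint_sdiff_sdiff, rfl, hsdiff.symm, h9,
    hNA, hNB, hinter, hTA⟩
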